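/- Let $\mathcal B$ be an exact category (in the sense of Quillen: an additive category with a class of kernel-cokernel pairs, called short exact sequences $X\rightarrowtail Y\twoheadrightarrow Z$, stable under isomorphisms, direct sums and direct summands, such that identities are inflations and deflations, inflations and deflations are closed under composition, and inflations (resp. deflations) admit push-outs (resp. pull-backs) along arbitrary morphisms, which are again inflations (resp. deflations)). Assume that $\mathcal B$ has enough projectives and enough injectives. Let $(\mathcal U,\mathcal V)$ be a cotorsion pair on $\mathcal B$, that is, $\mathcal U$ and $\mathcal V$ are full additive subcategories of $\mathcal B$ closed under direct summands such that $\operatorname{Ext}^1_{\mathcal B}(U,V)=0$ for all $U\in\mathcal U$, $V\in\mathcal V$ (every short exact sequence $V\rightarrowtail E\twoheadrightarrow U$ splits), and every object $B$ of $\mathcal B$ admits short exact sequences $$V_B\rightarrowtail U_B\twoheadrightarrow B,\qquad B\rightarrowtail V^B\twoheadrightarrow U^B$$ with $U_B,U^B\in\mathcal U$ and $V_B,V^B\in\mathcal V$. Put $\mathcal W=\mathcal U\cap\mathcal V$. Let $\mathcal B^+$ be the full subcategory of the objects $B$ admitting a short exact sequence $V_B\rightarrowtail W_B\twoheadrightarrow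 B$ with $W_B\in\mathcal W$, $V_B\in\mathcal V$, and let $\mathcal B^-$ be the full subcategory of the objects $B$ admitting a short exact sequence $B\rightarrowtail W^B\twoheadrightarrow U^B$ with $W^B\in\mathcal W$, $U^B\in\mathcal U$. Then the heart $$\underline{\mathcal H}=(\mathcal B^+\cap\mathcal B^-)/\mathcal W,$$ whose objects are those of $\mathcal B^+\cap\mathcal B^-$ and whose morphisms are the morphisms of $\mathcal B$ modulo those factoring through an object of $\mathcal W$, is an abelian category. -/

import Mathlib

open CategoryTheory CategoryTheory.Limits

universe v u

namespace ExactCat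

variable {C : Type u} [Category.{v} C] [Preadditive C]

/-- For a class `P` of composable pairs with zero composite, `i` is an inflation if it is the
first morphism of a pair in `P`. -/
def IsInflation (P : ObjectProperty (ShortComplex C)) {X Y : C} (i : X ⟶ Y) : Prop :=
  ∃ (Z : C) (d : Y ⟶ Z) (w : i ≫ d = 0), P (ShortComplex.mk i d w)

/-- For a class `P` of composable pairs with zero composite, `d` is a deflation if it is the
second morphism of a pair in `P`. -/
def IsDeflation (P : ObjectProperty (ShortComplex C)) {Y Z : C} (d : Y ⟶ Z) : Prop :=
  ∃ (X : C) (i : X ⟶ Y) (w : i ≫ d = 0), P (ShortComplex.mk i d w)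

/-- The termwise direct sum of two composable pairs with zero composite. -/
noncomputable def directSum [HasBinaryBiproducts C] (S T : ShortComplex C) : ShortComplex C :=
  ShortComplex.mk (biprod.map S.f T.f) (biprod.map S.g T.g) (by
    ext <;> simp)

variable (C) in
/-- A (Quillen) exact structure on an additive category `C`: a class of kernel-cokernel pairs,
called short exact sequences, stable under isomorphisms, direct sums and direct summands, such
that identities are inflations and deflations, inflations and deflations are stable under
composition, deflations have pull-backs along arbitrary morphisms which are again deflations, and
inflations have push-outs along arbitrary morphisms which are again inflations. -/
structure ExactStructure [HasBinaryBiproducts C] where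
  /-- the class of short exact sequences -/
  shortExact : ObjectProperty (ShortComplex C)
  isKernel : ∀ S : ShortComplex C, shortExact S →
    Nonempty (IsLimit (KernelFork.ofι S.f S.zero))
  isCokernel : ∀ S : ShortComplex C, shortExact S →
    Nonempty (IsColimit (CokernelCofork.ofπ S.g S.zero))
  of_iso : ∀ S T : ShortComplex C, Nonempty (S ≅ T) → shortExact S → shortExact T
  directSum_mem : ∀ S T : ShortComplex C, shortExact S → shortExact T →
    shortExact (directSum S T)
  of_directSum_mem : ∀ S T : ShortComplex C, shortExact (directSum S T) → shortExact S
  id_isInflation : ∀ X : C, IsInflation shortExact (𝟙 X)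
  id_isDeflation : ∀ X : C, IsDeflation shortExact (𝟙 X)
  comp_isInflation : ∀ {X Y Z : C} (i : X ⟶ Y) (j : Y ⟶ Z),
    IsInflation shortExact i → IsInflation shortExact j → IsInflation shortExact (i ≫ j)
  comp_isDeflation : ∀ {X Y Z : C} (p : X ⟶ Y) (q : Y ⟶ Z),
    IsDeflation shortExact p → IsDeflation shortExact q → IsDeflation shortExact (p ≫ q)
  exists_pullback : ∀ {Y Z Z' : C} (d : Y ⟶ Z) (f : Z' ⟶ Z), IsDeflation shortExact d →
    ∃ (Y' : C) (f' : Y' ⟶ Y) (d' : Y' ⟶ Z'),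
      IsDeflation shortExact d' ∧ IsPullback f' d' d f
  exists_pushout : ∀ {X Y X' : C} (i : X ⟶ Y) (g : X ⟶ X'), IsInflation shortExact i →
    ∃ (Y' : C) (g' : Y ⟶ Y') (i' : X' ⟶ Y'),
      IsInflation shortExact i' ∧ IsPushout i g g' i'

section Exact

variable [HasBinaryBiproducts C] (E : ExactStructure C)

/-- `X ⟶ Y ⟶ Z` is a short exact sequence for the exact structure `E`. -/
def IsShortExact {X Y Z : C} (i : X ⟶ Y) (d : Y ⟶ Z) : Prop :=
  ∃ w : i ≫ d = 0, E.shortExact (ShortComplex.mk i d w)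

/-- `P` is projective with respect to the deflations of `E`. -/
def IsProjective (P : C) : Prop :=
  ∀ ⦃X Y : C⦄ (f : X ⟶ Y) (g : P ⟶ Y), IsDeflation E.shortExact f → ∃ h : P ⟶ X, h ≫ f = g

/-- `I` is injective with respect to the inflations of `E`. -/
def IsInjective (I : C) : Prop :=
  ∀ ⦃X Y : C⦄ (f : X ⟶ Y) (g : X ⟶ I), IsInflation E.shortExact f → ∃ h : Y ⟶ I, f ≫ h = g

/-- Every object is the target of a deflation from a projective object. -/
def HasEnoughProjectives : Prop :=
  ∀ X : C, ∃ (P : C) (p : P ⟶ X), IsProjective E P ∧ IsDeflation E.shortExact p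

/-- Every object is the source of an inflation to an injective object. -/
def HasEnoughInjectives : Prop :=
  ∀ X : C, ∃ (I : C) (i : X ⟶ I), IsInjective E I ∧ IsInflation E.shortExact i

/-- `Ext¹(X, Y) = 0`: every short exact sequence `Y ⟶ T ⟶ X` splits, i.e. there is only one
equivalence class of extensions of `X` by `Y`. -/
def ExtOneVanishes (X Y : C) : Prop :=
  ∀ (T : C) (i : Y ⟶ T) (d : T ⟶ X) (w : i ≫ d = 0), E.shortExact (ShortComplex.mk i d w) →
    Nonempty (ShortComplex.mk i d w).Splitting

end Exact

/-- The objects satisfying `U` form a full additive subcategory (containing the zero objects,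
closed under isomorphisms and finite direct sums) which is closed under direct summands. -/
structure IsAdditiveSummandClosed [HasBinaryBiproducts C] (U : ObjectProperty C) : Prop where
  of_iso : ∀ X Y : C, Nonempty (X ≅ Y) → U X → U Y
  of_isZero : ∀ Z : C, IsZero Z → U Z
  biprod_mem : ∀ X Y : C, U X → U Y → U (X ⊞ Y)
  of_biprod_mem : ∀ X Y : C, U (X ⊞ Y) → U X

/-- A cotorsion pair `(U, V)` in the exact category `(C, E)`. -/
structure CotorsionPair [HasBinaryBiproducts C] (E : ExactStructure C) where
  /-- the left class -/
  U : ObjectProperty C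
  /-- the right class -/
  V : ObjectProperty C
  additive_U : IsAdditiveSummandClosed U
  additive_V : IsAdditiveSummandClosed V
  ext_vanishes : ∀ X Y : C, U X → V Y → ExtOneVanishes E X Y
  exists_left : ∀ B : C, ∃ (V_B U_B : C) (i : V_B ⟶ U_B) (d : U_B ⟶ B),
    V V_B ∧ U U_B ∧ IsShortExact E i d
  exists_right : ∀ B : C, ∃ (VB UB : C) (i : B ⟶ VB) (d : VB ⟶ UB),
    V VB ∧ U UB ∧ IsShortExact E i d

/-- Two parallel morphisms are related if their difference factors through an object of `W`. -/
def factorRel (W : ObjectProperty C) : HomRel C :=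
  fun X Y f g => ∃ (Z : C) (a : X ⟶ Z) (b : Z ⟶ Y), W Z ∧ a ≫ b = f - g

theorem factorRel_add [HasBinaryBiproducts C] {W : ObjectProperty C}
    (hW : ∀ X Y : C, W X → W Y → W (X ⊞ Y)) ⦃X Y : C⦄ (f₁ f₂ g₁ g₂ : X ⟶ Y)
    (hf : factorRel W f₁ f₂) (hg : factorRel W g₁ g₂) :
    factorRel W (f₁ + g₁) (f₂ + g₂) := by
  obtain ⟨Z, a, b, hZ, h⟩ := hf
  obtain ⟨Z', a', b', hZ', h'⟩ := hg
  refine ⟨Z ⊞ Z', biprod.lift a a', biprod.desc b b', hW _ _ hZ hZ', ?_⟩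
  rw [biprod.lift_desc, h, h']
  abel

theorem factorRel_congruence [HasBinaryBiproducts C] {W : ObjectProperty C}
    (hW : ∀ X Y : C, W X → W Y → W (X ⊞ Y)) (h0 : ∃ Z : C, W Z) :
    Congruence (factorRel W) where
  comp_left f g g' h := by
    obtain ⟨Z, a, b, hZ, h⟩ := h
    exact ⟨Z, f ≫ a, b, hZ, by rw [Category.assoc, h, Preadditive.comp_sub]⟩
  comp_right g h := by
    obtain ⟨Z, a, b, hZ, h⟩ := h
    exact ⟨Z, a, b ≫ g, hZ, by rw [← Category.assoc, h, Preadditive.sub_comp]⟩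
  equivalence :=
    { refl := fun f => by
        obtain ⟨Z, hZ⟩ := h0
        exact ⟨Z, 0, 0, hZ, by simp⟩
      symm := fun {f g} h => by
        obtain ⟨Z, a, b, hZ, h⟩ := h
        exact ⟨Z, -a, b, hZ, by rw [Preadditive.neg_comp, h]; abel⟩
      trans := fun {f g k} h h' => by
        obtain ⟨Z, a, b, hZ, h⟩ := h
        obtain ⟨Z', a', b', hZ', h'⟩ := h'
        refine ⟨Z ⊞ Z', biprod.lift a a', biprod.desc b b', hW _ _ hZ hZ', ?_⟩
        rw [biprod.lift_desc, h, h']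
        abel }

namespace CotorsionPair

variable [HasBinaryBiproducts C] {E : ExactStructure C} (P : CotorsionPair E)

/-- The intersection `W = U ∩ V`. -/
def W : ObjectProperty C := fun X => P.U X ∧ P.V X

/-- The objects `B` with a short exact sequence `V_B ⟶ U_B ⟶ B`, where `U_B ∈ U ∩ V` and
`V_B ∈ V`. -/
def plus : ObjectProperty C := fun B =>
  ∃ (V_B U_B : C) (i : V_B ⟶ U_B) (d : U_B ⟶ B), P.V V_B ∧ P.W U_B ∧ IsShortExact E i d

/-- The objects `B` with a short exact sequence `B ⟶ VB ⟶ UB`, where `VB ∈ U ∩ V` and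
`UB ∈ U`. -/
def minus : ObjectProperty C := fun B =>
  ∃ (VB UB : C) (i : B ⟶ VB) (d : VB ⟶ UB), P.W VB ∧ P.U UB ∧ IsShortExact E i d

theorem W_biprod (X Y : C) (hX : P.W X) (hY : P.W Y) : P.W (X ⊞ Y) :=
  ⟨P.additive_U.biprod_mem X Y hX.1 hY.1, P.additive_V.biprod_mem X Y hX.2 hY.2⟩

variable [HasZeroObject C]

theorem exists_W : ∃ Z : C, P.W Z := by
  obtain ⟨Z, hZ⟩ := HasZeroObject.zero (C := C)
  exact ⟨Z, P.additive_U.of_isZero Z hZ, P.additive_V.of_isZero Z hZ⟩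

instance : Congruence (factorRel P.W) :=
  factorRel_congruence P.W_biprod P.exists_W

/-- The additive quotient category `C / W`: same objects, and morphisms modulo those
that factor through an object of `W`. -/
abbrev StableCategory : Type u := CategoryTheory.Quotient (factorRel P.W)

instance : Preadditive P.StableCategory :=
  CategoryTheory.Quotient.preadditive (factorRel P.W) (factorRel_add P.W_biprod)

/-- The heart `(B⁺ ∩ B⁻) / W`: the full subcategory of `C / W` on the objects lying in both
`plus` and `minus`. -/
abbrev Heart : Type u :=
  ObjectProperty.FullSubcategory (fun X : P.StableCategory => P.plus X.as ∧ P.minus X.as)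

end CotorsionPair

end ExactCat

/-! ### The opposite exact structure. -/

namespace ExactCat

open Opposite

variable {C : Type u} [Category.{v} C] [Preadditive C]

/-! The setting is self-dual: `ExactStructure.op` and `CotorsionPair.op` exchange `U` with `V` and
`plus` with `minus`. So cokernels are built by hand and kernels are obtained from the opposite
category. Two observations drive the argument. A map from an object of `U` to an object of `plus`,
or from an object of `minus` to an object of `V`, factors through `W`, and this property
characterises `plus` and `minus` (`plus_of_forall`, `minus_of_forall`). Consequently, a map into an
object of `plus` vanishes modulo `W` as soon as it does so after precomposition with an inflation
whose cokernel is in `U` (`factorsThru_of_inflation_comp`). Given `f : A ⟶ B` in the heart and `A ⟶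
W ⟶ U` witnessing `minus A`, let `M` be the cokernel of `(f, i) : A ⟶ B ⊞ W`. Then `B ⟶ M` is an
inflation with cokernel `U`. The reflection `D` of `M` in `plus` is the cokernel of `f` in the heart
(`exists_cokernel`). If `f` is monic modulo `W`, take `L ⟶ M` with `L` in `U` and kernel in `V`, and
pull back `B ⊞ W ⟶ M` along it to get `N`, an extension of `L` by `A`. The inflation `A ⟶ N` is
again monic modulo `W`, which forces `L` into `W` (`exists_retraction`). So `A` and `N` agree in the
heart, and maps killed by `B ⟶ D` lift to `N`. Hence every mono is the kernel of its cokernel, and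
dually. -/

theorem isInflation_op_iff {P : ObjectProperty (ShortComplex C)} {X Y : C} (i : X ⟶ Y) :
    IsDeflation (fun S : ShortComplex Cᵒᵖ => P S.unop) i.op ↔ IsInflation P i := by
  constructor
  · rintro ⟨Z, d, w, h⟩
    exact ⟨Z.unop, d.unop, Quiver.Hom.op_inj w, h⟩
  · rintro ⟨Z, d, w, h⟩
    exact ⟨op Z, d.op, Quiver.Hom.unop_inj w, h⟩

theorem isDeflation_op_iff {P : ObjectProperty (ShortComplex C)} {X Y : C} (d : X ⟶ Y) :
    IsInflation (fun S : ShortComplex Cᵒᵖ => P S.unop) d.op ↔ IsDeflation P d := by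
  constructor
  · rintro ⟨Z, i, w, h⟩
    exact ⟨Z.unop, i.unop, Quiver.Hom.op_inj w, h⟩
  · rintro ⟨Z, i, w, h⟩
    exact ⟨op Z, i.op, Quiver.Hom.unop_inj w, h⟩

/-- The biproduct in the opposite category is the biproduct. -/
noncomputable def unopBiprodIso [HasBinaryBiproducts C] (X Y : Cᵒᵖ) :
    (X ⊞ Y).unop ≅ X.unop ⊞ Y.unop where
  hom := biprod.lift (biprod.inl : X ⟶ X ⊞ Y).unop (biprod.inr : Y ⟶ X ⊞ Y).unop
  inv := biprod.desc (biprod.fst : X ⊞ Y ⟶ X).unop (biprod.snd : X ⊞ Y ⟶ Y).unop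
  hom_inv_id := by
    rw [biprod.lift_desc, ← unop_comp, ← unop_comp, ← unop_add, biprod.total, unop_id]
  inv_hom_id := by
    ext <;> simp [← unop_comp]

theorem unopBiprodIso_hom_map [HasBinaryBiproducts C] {X Y X' Y' : Cᵒᵖ} (f : X ⟶ X')
    (g : Y ⟶ Y') :
    (unopBiprodIso X' Y').hom ≫ biprod.map f.unop g.unop =
      (biprod.map f g).unop ≫ (unopBiprodIso X Y).hom := by
  simp only [unopBiprodIso]
  ext <;> simp [← unop_comp]

/-- Unopping a direct sum of composable pairs. -/
noncomputable def unopDirectSumIso [HasBinaryBiproducts C] (S T : ShortComplex Cᵒᵖ) :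
    (directSum S T).unop ≅ directSum S.unop T.unop :=
  ShortComplex.isoMk (unopBiprodIso _ _) (unopBiprodIso _ _) (unopBiprodIso _ _)
    (unopBiprodIso_hom_map S.g T.g) (unopBiprodIso_hom_map S.f T.f)

/-- The opposite exact structure. -/
def ExactStructure.op [HasBinaryBiproducts C] (E : ExactStructure C) : ExactStructure Cᵒᵖ where
  shortExact S := E.shortExact S.unop
  isKernel S h := by
    obtain ⟨l⟩ := E.isCokernel _ h
    exact ⟨CokernelCofork.IsColimit.ofπOp S.unop.g S.unop.zero l⟩
  isCokernel S h := by
    obtain ⟨l⟩ := E.isKernel _ h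
    exact ⟨KernelFork.IsLimit.ofιOp S.unop.f S.unop.zero l⟩
  of_iso S T := by
    rintro ⟨e⟩ h
    exact E.of_iso _ _ ⟨(ShortComplex.opEquiv C).inverse.mapIso e.symm |>.unop.symm.symm⟩ h
  directSum_mem S T hS hT :=
    E.of_iso _ _ ⟨(unopDirectSumIso S T).symm⟩ (E.directSum_mem _ _ hS hT)
  of_directSum_mem S T h :=
    E.of_directSum_mem _ T.unop (E.of_iso _ _ ⟨unopDirectSumIso S T⟩ h)
  id_isInflation X := (isDeflation_op_iff _).2 (E.id_isDeflation X.unop)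
  id_isDeflation X := (isInflation_op_iff _).2 (E.id_isInflation X.unop)
  comp_isInflation i j hi hj :=
    (isDeflation_op_iff _).2 (E.comp_isDeflation j.unop i.unop ((isDeflation_op_iff _).1 hj)
      ((isDeflation_op_iff _).1 hi))
  comp_isDeflation i j hi hj :=
    (isInflation_op_iff _).2 (E.comp_isInflation j.unop i.unop ((isInflation_op_iff _).1 hj)
      ((isInflation_op_iff _).1 hi))
  exists_pullback d f hd := by
    obtain ⟨Y', g', i', h, sq⟩ := E.exists_pushout d.unop f.unop ((isInflation_op_iff _).1 hd)
    exact ⟨.op Y', g'.op, i'.op, (isInflation_op_iff _).2 h, sq.op.flip⟩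
  exists_pushout i g hi := by
    obtain ⟨Y', f', d', h, sq⟩ := E.exists_pullback i.unop g.unop ((isDeflation_op_iff _).1 hi)
    exact ⟨.op Y', f'.op, d'.op, (isDeflation_op_iff _).2 h, sq.op.flip⟩

/-! ### Short exact sequences: base change, composition, splitting. -/

section

variable [HasBinaryBiproducts C] {E : ExactStructure C}

theorem IsShortExact.op {X Y Z : C} {i : X ⟶ Y} {d : Y ⟶ Z} (h : IsShortExact E i d) :
    IsShortExact E.op d.op i.op :=
  ⟨Quiver.Hom.unop_inj h.1, h.2⟩

theorem IsShortExact.unop {X Y Z : Cᵒᵖ} {i : X ⟶ Y} {d : Y ⟶ Z} (h : IsShortExact E.op i d) :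
    IsShortExact E d.unop i.unop :=
  ⟨Quiver.Hom.op_inj h.1, h.2⟩

namespace IsShortExact

variable {X Y Z : C} {i : X ⟶ Y} {d : Y ⟶ Z} (h : IsShortExact E i d)

include h

theorem w : i ≫ d = 0 := h.1

theorem isInflation : IsInflation E.shortExact i := ⟨Z, d, h.1, h.2⟩

theorem isDeflation : IsDeflation E.shortExact d := ⟨X, i, h.1, h.2⟩

theorem exists_lift {T : C} (t : T ⟶ Y) (ht : t ≫ d = 0) : ∃ s : T ⟶ X, s ≫ i = t := by
  obtain ⟨l⟩ := E.isKernel _ h.2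
  exact ⟨_, (KernelFork.IsLimit.lift' l t ht).2⟩

theorem exists_desc {T : C} (t : Y ⟶ T) (ht : i ≫ t = 0) : ∃ s : Z ⟶ T, d ≫ s = t := by
  obtain ⟨l⟩ := E.isCokernel _ h.2
  exact ⟨_, (CokernelCofork.IsColimit.desc' l t ht).2⟩

theorem mono : Mono i := by
  obtain ⟨l⟩ := E.isKernel _ h.2
  exact Fork.IsLimit.mono l

theorem epi : Epi d := by
  obtain ⟨l⟩ := E.isCokernel _ h.2
  exact Cofork.IsColimit.epi l

/-- A sequence with a monic kernel that has the same deflation is short exact. -/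
theorem of_isKernel {X' : C} (i' : X' ⟶ Y) (w : i' ≫ d = 0) [Mono i']
    (hl : ∃ s : X ⟶ X', s ≫ i' = i) : IsShortExact E i' d := by
  obtain ⟨s, hs⟩ := hl
  obtain ⟨t, ht⟩ := h.exists_lift i' w
  have := h.mono
  let e : X ≅ X' := ⟨s, t, by rw [← cancel_mono i]; simp [ht, hs],
    by rw [← cancel_mono i']; simp [ht, hs]⟩
  exact ⟨w, E.of_iso (.mk i d h.w) _ ⟨ShortComplex.isoMk e (Iso.refl _) (Iso.refl _)
    (by simp [e, hs]) (by simp)⟩ h.2⟩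

theorem of_iso {X' Y' Z' : C} {i' : X' ⟶ Y'} {d' : Y' ⟶ Z'} (e₁ : X ≅ X') (e₂ : Y ≅ Y')
    (e₃ : Z ≅ Z') (h₁ : e₁.hom ≫ i' = i ≫ e₂.hom) (h₂ : e₂.hom ≫ d' = d ≫ e₃.hom) :
    IsShortExact E i' d' := by
  have w : i' ≫ d' = 0 := by
    rw [← cancel_epi e₁.hom, ← Category.assoc, h₁, Category.assoc, h₂, reassoc_of% h.w]
    simp
  exact ⟨w, E.of_iso _ _ ⟨ShortComplex.isoMk e₁ e₂ e₃ h₁ h₂⟩ h.2⟩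

/-- The pullback of a short exact sequence. -/
theorem of_isPullback {Y' Z' : C} {f' : Y' ⟶ Y} {d' : Y' ⟶ Z'} {f : Z' ⟶ Z}
    (sq : IsPullback f' d' d f) :
    ∃ i' : X ⟶ Y', i' ≫ f' = i ∧ IsShortExact E i' d' := by
  obtain ⟨i', hi₁, hi₂⟩ := sq.exists_lift i 0 (by simp [h.w])
  refine ⟨i', hi₁, ?_⟩
  -- The axiom gives a deflation only for some pullback square. It is transported to the given
  -- square, and the kernel obtained there is then compared with `i'`.
  obtain ⟨Y'', f'', d'', ⟨X'', i'', w'', h''⟩, sq'⟩ := E.exists_pullback d f h.isDeflation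
  have h'' : IsShortExact E i'' d'' := ⟨w'', h''⟩
  have := h.mono
  have e : IsShortExact E (i'' ≫ (sq'.isoIsPullback _ _ sq).hom) d' :=
    h''.of_iso (Iso.refl _) (sq'.isoIsPullback _ _ sq) (Iso.refl _) (by simp) (by simp)
  have : Mono i' := by
    have : Mono (i' ≫ f') := by rw [hi₁]; infer_instance
    exact mono_of_mono i' f'
  refine e.of_isKernel i' hi₂ ?_
  obtain ⟨s, hs⟩ := h.exists_lift (i'' ≫ f'') (by
    rw [Category.assoc, sq'.w, reassoc_of% w'', zero_comp])
  refine ⟨s, sq.hom_ext ?_ ?_⟩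
  · simp [hi₁, hs]
  · simp [hi₂, w'']

theorem exists_pullback {Z' : C} (f : Z' ⟶ Z) :
    ∃ (Y' : C) (i' : X ⟶ Y') (f' : Y' ⟶ Y) (d' : Y' ⟶ Z'),
      i' ≫ f' = i ∧ IsPullback f' d' d f ∧ IsShortExact E i' d' := by
  obtain ⟨Y', f', d', -, sq⟩ := E.exists_pullback d f h.isDeflation
  obtain ⟨i', hi, h'⟩ := h.of_isPullback sq
  exact ⟨Y', i', f', d', hi, sq, h'⟩

/-- The pushout of a short exact sequence. -/
theorem of_isPushout {X' Y' : C} {g' : Y ⟶ Y'} {i' : X' ⟶ Y'} {g : X ⟶ X'}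
    (sq : IsPushout i g g' i') :
    ∃ d' : Y' ⟶ Z, g' ≫ d' = d ∧ IsShortExact E i' d' := by
  obtain ⟨d', h₁, h₂⟩ := h.op.of_isPullback sq.flip.op
  exact ⟨d'.unop, Quiver.Hom.op_inj h₁, h₂.unop⟩

/-- Composing a deflation with kernel `A` and a deflation with kernel `X` gives a deflation whose
kernel is an extension of `X` by `A`. -/
theorem exists_comp {A T : C} {a : A ⟶ T} {p : T ⟶ Y} (h' : IsShortExact E a p) :
    ∃ (K : C) (k : K ⟶ T) (q : K ⟶ X) (b : A ⟶ K),
      IsShortExact E k (p ≫ d) ∧ IsShortExact E b q ∧ b ≫ k = a ∧ IsPullback k q p i := by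
  obtain ⟨K, k, w, hk⟩ := E.comp_isDeflation p d h'.isDeflation h.isDeflation
  have hk : IsShortExact E k (p ≫ d) := ⟨w, hk⟩
  have := h.mono
  have := hk.mono
  obtain ⟨q, hq⟩ := h.exists_lift (k ≫ p) (by simpa using w)
  have sq : IsPullback k q p i := by
    refine ⟨⟨hq.symm⟩, ⟨PullbackCone.IsLimit.mk _
      (fun s => (hk.exists_lift s.fst (by rw [reassoc_of% s.condition, h.w, comp_zero])).choose)
      (fun s => (hk.exists_lift s.fst (by
        rw [reassoc_of% s.condition, h.w, comp_zero])).choose_spec) (fun s => ?_) ?_⟩⟩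
    · rw [← cancel_mono i, Category.assoc, hq, ← Category.assoc,
        (hk.exists_lift s.fst (by rw [reassoc_of% s.condition, h.w, comp_zero])).choose_spec,
        s.condition]
    · intro s m h₁ _
      rw [← cancel_mono k, h₁, (hk.exists_lift s.fst (by
        rw [reassoc_of% s.condition, h.w, comp_zero])).choose_spec]
  obtain ⟨b, hb, hs⟩ := h'.of_isPullback sq
  exact ⟨K, k, q, b, hk, hs, hb, sq⟩

/-- Composing an inflation with cokernel `Z` and an inflation with cokernel `A` gives an inflation
whose cokernel is an extension of `A` by `Z`. -/
theorem exists_comp' {A T : C} {p : Y ⟶ T} {a : T ⟶ A} (h' : IsShortExact E p a) :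
    ∃ (K : C) (k : T ⟶ K) (q : Z ⟶ K) (b : K ⟶ A),
      IsShortExact E (i ≫ p) k ∧ IsShortExact E q b ∧ k ≫ b = a ∧ IsPushout d p q k := by
  obtain ⟨K, k, q, b, h₁, h₂, h₃, sq⟩ := h.op.exists_comp h'.op
  exact ⟨_, k.unop, q.unop, b.unop, h₁.unop, h₂.unop, Quiver.Hom.op_inj h₃,
    sq.unop⟩

/-- A section of the deflation splits the sequence. -/
theorem iso_of_section (s : Z ⟶ Y) (hs : s ≫ d = 𝟙 Z) : Nonempty (Y ≅ Z ⊞ X) := by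
  obtain ⟨r, hr⟩ := h.exists_lift (𝟙 Y - d ≫ s) (by simp [hs])
  have := h.mono
  have h₁ : i ≫ r = 𝟙 X := by rw [← cancel_mono i]; simp [hr, reassoc_of% h.w]
  have h₂ : s ≫ r = 0 := by rw [← cancel_mono i]; simp [hr, reassoc_of% hs]
  exact ⟨⟨biprod.lift d r, biprod.desc s i, by simp [hr], by
    ext <;> simp [h₁, h₂, hs, h.w]⟩⟩

theorem exists_section_of_retraction (r : Y ⟶ X) (hr : i ≫ r = 𝟙 X) :
    ∃ s : Z ⟶ Y, s ≫ d = 𝟙 Z := by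
  obtain ⟨s, hs⟩ := h.exists_desc (𝟙 Y - r ≫ i) (by simp [reassoc_of% hr])
  have := h.epi
  exact ⟨s, by rw [← cancel_epi d, reassoc_of% hs]; simp [h.w]⟩

theorem exists_retraction_of_section (s : Z ⟶ Y) (hs : s ≫ d = 𝟙 Z) :
    ∃ r : Y ⟶ X, i ≫ r = 𝟙 X := by
  obtain ⟨r, hr⟩ := h.exists_lift (𝟙 Y - d ≫ s) (by simp [hs])
  have := h.mono
  exact ⟨r, by rw [← cancel_mono i]; simp [hr, reassoc_of% h.w]⟩

end IsShortExact

theorem isShortExact_id_zero (X : C) : ∃ Z : C, IsShortExact E (𝟙 X) (0 : X ⟶ Z) := by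
  obtain ⟨Z, d, w, h⟩ := E.id_isInflation X
  obtain rfl : d = 0 := by simpa using w
  exact ⟨Z, w, h⟩

theorem isShortExact_zero_id (X : C) : ∃ Z : C, IsShortExact E (0 : Z ⟶ X) (𝟙 X) := by
  obtain ⟨Z, d, w, h⟩ := E.id_isDeflation X
  obtain rfl : d = 0 := by simpa using w
  exact ⟨Z, w, h⟩

theorem isInflation_biprod_map_id {X Y Z : C} {i : X ⟶ Y} {d : Y ⟶ Z} (h : IsShortExact E i d)
    (B : C) : IsInflation E.shortExact (biprod.map (𝟙 B) i) := by
  obtain ⟨B₀, hB⟩ := isShortExact_id_zero (E := E) B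
  exact IsShortExact.isInflation ⟨_, E.directSum_mem _ _ hB.2 h.2⟩

/-- Direct sum of the trivial sequences `0 ⟶ A ⟶ A` and `B ⟶ B ⟶ 0`, after identifying `0 ⊞ B` with
`B`. -/
theorem isInflation_inr (A B : C) : IsInflation E.shortExact (biprod.inr : B ⟶ A ⊞ B) := by
  obtain ⟨A₀, hA⟩ := isShortExact_zero_id (E := E) A
  obtain ⟨B₀, hB⟩ := isShortExact_id_zero (E := E) B
  have hA0 : IsZero A₀ := by
    have := hA.mono
    rw [IsZero.iff_id_eq_zero, ← cancel_mono (0 : A₀ ⟶ A)]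
    simp
  have h : IsShortExact E (biprod.map (0 : A₀ ⟶ A) (𝟙 B)) (biprod.map (𝟙 A) (0 : B ⟶ B₀)) :=
    ⟨_, E.directSum_mem _ _ hA.2 hB.2⟩
  refine (h.of_iso ⟨biprod.snd, biprod.inr, ?_, by simp⟩ (Iso.refl _) (Iso.refl _)
    (d' := biprod.map (𝟙 A) (0 : B ⟶ B₀)) ?_ (by simp)).isInflation
  · ext <;> simp
    exact hA0.eq_of_src _ _
  · ext <;> simp

theorem isInflation_of_isIso {X Y : C} (e : X ≅ Y) : IsInflation E.shortExact e.hom := by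
  obtain ⟨Z, h⟩ := isShortExact_id_zero (E := E) Y
  exact (h.of_iso e.symm (Iso.refl _) (Iso.refl _) (by simp) (d' := 0) (by simp)).isInflation

/-- If `A ⟶ W ⟶ Z` is short exact and `f : A ⟶ B`, then `(f, i) : A ⟶ B ⊞ W` is an inflation,
whose cokernel is an extension of `Z` by `B`. -/
theorem IsShortExact.exists_biprod_lift {A W Z : C} {i : A ⟶ W} {d : W ⟶ Z}
    (h : IsShortExact E i d) {B : C} (f : A ⟶ B) :
    ∃ (M : C) (b : B ⟶ M) (w : W ⟶ M) (e : M ⟶ Z),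
      IsShortExact E (biprod.lift f i) (biprod.desc b w) ∧ IsShortExact E b e := by
  let θ : B ⊞ A ≅ B ⊞ A :=
    ⟨biprod.lift (biprod.fst + biprod.snd ≫ f) biprod.snd,
      biprod.lift (biprod.fst - biprod.snd ≫ f) biprod.snd, by ext <;> simp, by ext <;> simp⟩
  -- `(f, i)` is `biprod.inr`, followed by the shear `θ`, followed by `𝟙 B ⊞ i`.
  have hi : IsInflation E.shortExact (biprod.lift f i) := by
    have := E.comp_isInflation _ _ (E.comp_isInflation _ _ (isInflation_inr B A)
      (isInflation_of_isIso θ)) (isInflation_biprod_map_id h B)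
    convert this using 1
    ext <;> simp [θ]
  obtain ⟨M, p, w, hp⟩ := hi
  have hp : IsShortExact E (biprod.lift f i) p := ⟨w, hp⟩
  obtain ⟨b, k, rfl⟩ : ∃ b k, p = biprod.desc b k :=
    ⟨biprod.inl ≫ p, biprod.inr ≫ p, by ext <;> simp⟩
  have hw : f ≫ b + i ≫ k = 0 := by simpa using w
  have := hp.epi
  -- The cokernel of `(f, i)` is a pushout of `i` and `f` up to sign, since the relation reads `f ≫
  -- b + i ≫ k = 0`. Hence the leg `-k`.
  have sq : IsPushout i f (-k) b := by
    have H (s : PushoutCocone i f) : biprod.lift f i ≫ biprod.desc s.inr (-s.inl) = 0 := by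
      simp [s.condition]
    refine ⟨⟨?_⟩, ⟨PushoutCocone.IsColimit.mk _
      (fun s => (hp.exists_desc _ (H s)).choose) (fun s => ?_) (fun s => ?_) ?_⟩⟩
    · rw [Preadditive.comp_neg, neg_eq_iff_add_eq_zero, add_comm, hw]
    · have := (hp.exists_desc _ (H s)).choose_spec
      have := congr(biprod.inr ≫ $this)
      simpa [neg_eq_iff_eq_neg] using this
    · have := (hp.exists_desc _ (H s)).choose_spec
      simpa using congr(biprod.inl ≫ $this)
    · intro s m h₁ h₂
      rw [← cancel_epi (biprod.desc b k), (hp.exists_desc _ (H s)).choose_spec]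
      ext
      · simpa using h₂
      · simp [← h₁]
  obtain ⟨e, -, he⟩ := h.of_isPushout sq
  exact ⟨M, b, k, e, hp, he⟩

end

end ExactCat

/-! ### Factoring through `W`, and the opposite cotorsion pair. -/

namespace ExactCat

open Opposite

variable {C : Type u} [Category.{v} C]

/-- The morphisms factoring through an object of `W`. -/
def FactorsThru (W : ObjectProperty C) {X Y : C} (f : X ⟶ Y) : Prop :=
  ∃ (Z : C) (a : X ⟶ Z) (b : Z ⟶ Y), W Z ∧ a ≫ b = f

namespace FactorsThru

variable {W : ObjectProperty C} {X Y Z : C}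

theorem comp_left {f : Y ⟶ Z} (h : FactorsThru W f) (g : X ⟶ Y) : FactorsThru W (g ≫ f) := by
  obtain ⟨T, a, b, hT, rfl⟩ := h
  exact ⟨T, g ≫ a, b, hT, by simp⟩

theorem comp_right {f : X ⟶ Y} (h : FactorsThru W f) (g : Y ⟶ Z) : FactorsThru W (f ≫ g) := by
  obtain ⟨T, a, b, hT, rfl⟩ := h
  exact ⟨T, a, b ≫ g, hT, by simp⟩

end FactorsThru

variable [Preadditive C]

theorem IsAdditiveSummandClosed.op [HasBinaryBiproducts C] {U : ObjectProperty C}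
    (h : IsAdditiveSummandClosed U) :
    IsAdditiveSummandClosed (fun X : Cᵒᵖ => U X.unop) where
  of_iso X Y := by
    rintro ⟨e⟩ hX
    exact h.of_iso _ _ ⟨e.unop.symm⟩ hX
  of_isZero Z hZ := h.of_isZero _ hZ.unop
  biprod_mem X Y hX hY := h.of_iso _ _ ⟨(unopBiprodIso X Y).symm⟩ (h.biprod_mem _ _ hX hY)
  of_biprod_mem X Y hXY := h.of_biprod_mem _ Y.unop (h.of_iso _ _ ⟨unopBiprodIso X Y⟩ hXY)

namespace CotorsionPair

variable [HasBinaryBiproducts C] {E : ExactStructure C} (P : CotorsionPair E)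

/-- The opposite cotorsion pair. -/
def op : CotorsionPair E.op where
  U X := P.V X.unop
  V X := P.U X.unop
  additive_U := P.additive_V.op
  additive_V := P.additive_U.op
  ext_vanishes X Y hX hY T i d w h := by
    obtain ⟨s⟩ := P.ext_vanishes Y.unop X.unop hY hX T.unop d.unop i.unop
      (Quiver.Hom.op_inj w) h
    exact ⟨s.op⟩
  exists_left B := by
    obtain ⟨V, U, i, d, hV, hU, h⟩ := P.exists_right B.unop
    exact ⟨.op U, .op V, d.op, i.op, hU, hV, h.op⟩
  exists_right B := by
    obtain ⟨V, U, i, d, hV, hU, h⟩ := P.exists_left B.unop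
    exact ⟨.op U, .op V, d.op, i.op, hU, hV, h.op⟩

theorem op_plus_iff (X : C) : P.op.plus (.op X) ↔ P.minus X := by
  constructor
  · rintro ⟨V, W, i, d, hV, hW, h⟩
    exact ⟨W.unop, V.unop, d.unop, i.unop, hW.symm, hV, h.unop⟩
  · rintro ⟨W, V, i, d, hW, hV, h⟩
    exact ⟨.op V, .op W, d.op, i.op, hV, hW.symm, h.op⟩

theorem op_minus_iff (X : C) : P.op.minus (.op X) ↔ P.plus X := by
  constructor
  · rintro ⟨W, V, i, d, hW, hV, h⟩
    exact ⟨V.unop, W.unop, d.unop, i.unop, hV, hW.symm, h.unop⟩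
  · rintro ⟨V, W, i, d, hV, hW, h⟩
    exact ⟨.op W, .op V, d.op, i.op, hW.symm, hV, h.op⟩

theorem op_factorsThru_iff {X Y : C} (f : X ⟶ Y) :
    FactorsThru P.op.W f.op ↔ FactorsThru P.W f := by
  constructor
  · rintro ⟨Z, a, b, hZ, h⟩
    exact ⟨Z.unop, b.unop, a.unop, hZ.symm, Quiver.Hom.op_inj h⟩
  · rintro ⟨Z, a, b, hZ, rfl⟩
    exact ⟨.op Z, b.op, a.op, hZ.symm, rfl⟩

/-! ### Lifting and extension, closure of `U` and `V`, criteria for `plus` and `minus`. -/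

variable {P}

theorem factorsThru_add {X Y : C} {f g : X ⟶ Y} (hf : FactorsThru P.W f)
    (hg : FactorsThru P.W g) : FactorsThru P.W (f + g) := by
  obtain ⟨S, a, b, hS, rfl⟩ := hf
  obtain ⟨T, a', b', hT, rfl⟩ := hg
  exact ⟨S ⊞ T, biprod.lift a a', biprod.desc b b', P.W_biprod _ _ hS hT, by simp⟩

theorem factorsThru_of_sub {X Y : C} {f g : X ⟶ Y} (h : FactorsThru P.W (f - g))
    (hg : FactorsThru P.W g) : FactorsThru P.W f := by
  simpa using factorsThru_add h hg

/-- Morphisms from `U` lift through deflations with kernel in `V`. -/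
theorem exists_lift {V Y Z U : C} {i : V ⟶ Y} {d : Y ⟶ Z} (h : IsShortExact E i d) (hV : P.V V)
    (hU : P.U U) (f : U ⟶ Z) : ∃ g : U ⟶ Y, g ≫ d = f := by
  obtain ⟨Y', i', f', d', -, sq, h'⟩ := h.exists_pullback f
  obtain ⟨s⟩ := P.ext_vanishes U V hU hV _ _ _ h'.1 h'.2
  exact ⟨s.s ≫ f', by rw [Category.assoc, sq.w, ← Category.assoc]; simp [s.s_g]⟩

/-- Morphisms to `V` extend along inflations with cokernel in `U`. -/
theorem exists_ext {X Y U V : C} {i : X ⟶ Y} {d : Y ⟶ U} (h : IsShortExact E i d) (hU : P.U U)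
    (hV : P.V V) (f : X ⟶ V) : ∃ g : Y ⟶ V, i ≫ g = f := by
  obtain ⟨g, hg⟩ := exists_lift (P := P.op) h.op hU hV f.op
  exact ⟨g.unop, Quiver.Hom.op_inj hg⟩

theorem U_of_section {V T Z : C} {i : V ⟶ T} {d : T ⟶ Z} (h : IsShortExact E i d) (hT : P.U T)
    (s : Z ⟶ T) (hs : s ≫ d = 𝟙 Z) : P.U Z := by
  obtain ⟨e⟩ := h.iso_of_section s hs
  exact P.additive_U.of_biprod_mem _ _ (P.additive_U.of_iso _ _ ⟨e⟩ hT)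

/-- Closure under summands does not apply to `T` directly, since the retract is not given a
complement. Lifting `r` along a deflation `U ⟶ X` with kernel in `V` gives that deflation a section,
and so exhibits `X` as a summand of `U`. -/
theorem U_of_retract {X T : C} (s : X ⟶ T) (r : T ⟶ X) (hs : s ≫ r = 𝟙 X) (hT : P.U T) :
    P.U X := by
  obtain ⟨V, U, i, d, hV, hU, h⟩ := P.exists_left X
  obtain ⟨t, ht⟩ := exists_lift h hV hT r
  exact U_of_section h hU (s ≫ t) (by simp [ht, hs])

theorem V_of_retract {X T : C} (s : X ⟶ T) (r : T ⟶ X) (hs : s ≫ r = 𝟙 X) (hT : P.V T) :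
    P.V X :=
  U_of_retract (P := P.op) r.op s.op (Quiver.Hom.unop_inj hs) hT

theorem U_of_extension {X Y Z : C} {i : X ⟶ Y} {d : Y ⟶ Z} (h : IsShortExact E i d) (hX : P.U X)
    (hZ : P.U Z) : P.U Y := by
  obtain ⟨V, U, a, p, hV, hU, h'⟩ := P.exists_left Y
  obtain ⟨K, k, q, b, hk, hb, hbk, sq⟩ := h.exists_comp h'
  -- The approximation of `Y` splits over `X`. The resulting retraction onto `V` extends to all of
  -- `U` because the cokernel `Z` of `k` lies in `U`, so the whole approximation splits.
  obtain ⟨s, hs⟩ := exists_lift hb hV hX (𝟙 X)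
  obtain ⟨r, hr⟩ := hb.exists_retraction_of_section s hs
  obtain ⟨r', hr'⟩ := exists_ext hk hZ hV r
  obtain ⟨t, ht⟩ := h'.exists_section_of_retraction r' (by rw [← hbk, Category.assoc, hr', hr])
  exact U_of_section h' hU t ht

theorem V_of_extension {X Y Z : C} {i : X ⟶ Y} {d : Y ⟶ Z} (h : IsShortExact E i d) (hX : P.V X)
    (hZ : P.V Z) : P.V Y :=
  U_of_extension (P := P.op) h.op hZ hX

theorem factorsThru_of_plus {U B : C} (hU : P.U U) (hB : P.plus B) (f : U ⟶ B) :
    FactorsThru P.W f := by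
  obtain ⟨V, W, i, d, hV, hW, h⟩ := hB
  obtain ⟨g, hg⟩ := exists_lift h hV hU f
  exact ⟨W, g, d, hW, hg⟩

theorem factorsThru_of_minus {B V : C} (hB : P.minus B) (hV : P.V V) (f : B ⟶ V) :
    FactorsThru P.W f := by
  rw [← op_factorsThru_iff]
  exact factorsThru_of_plus (P := P.op) hV ((op_plus_iff _ _).2 hB) f.op

theorem minus_of_forall {B : C} (hB : ∀ ⦃V : C⦄ (f : B ⟶ V), P.V V → FactorsThru P.W f) :
    P.minus B := by
  obtain ⟨V, U, i, d, hV, hU, h⟩ := P.exists_right B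
  obtain ⟨W, a, b, hW, hab⟩ := hB i hV
  -- `Q` is an extension of `U` by `W`, hence lies in `U`. The map `(-b, 𝟙)` kills `(a, i)` because
  -- `a ≫ b = i`, so it descends to `Q` and makes `V` a retract of `Q`.
  obtain ⟨Q, w, k, e, hQ, hwe⟩ := h.exists_biprod_lift a
  have hQU : P.U Q := U_of_extension hwe hW.1 hU
  obtain ⟨r, hr⟩ := hQ.exists_desc (biprod.desc (-b) (𝟙 V)) (by simp [hab])
  have hr : k ≫ r = 𝟙 V := by simpa using congr(biprod.inr ≫ $hr)
  exact ⟨V, U, i, d, ⟨U_of_retract k r hr hQU, hV⟩, hU, h⟩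

theorem plus_of_forall {B : C} (hB : ∀ ⦃U : C⦄ (f : U ⟶ B), P.U U → FactorsThru P.W f) :
    P.plus B := by
  rw [← op_minus_iff]
  exact minus_of_forall fun V f hV => (op_factorsThru_iff P f.unop).2 (hB f.unop hV)

theorem minus_of_U {B : C} (hB : P.U B) : P.minus B := by
  refine minus_of_forall fun V f hV => ?_
  obtain ⟨V', U, i, d, hV', hU, h⟩ := P.exists_left V
  obtain ⟨g, hg⟩ := exists_lift h hV' hB f
  exact ⟨U, g, d, ⟨hU, V_of_extension h hV' hV⟩, hg⟩

theorem plus_of_V {B : C} (hB : P.V B) : P.plus B :=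
  (op_minus_iff P B).1 (minus_of_U (P := P.op) hB)

/-- The part through `W` lifts along `d`. Subtracting the lift leaves a map through the kernel `V`,
which factors through `W` because `T` is in `minus`. -/
theorem factorsThru_of_comp_deflation {V Y Z T : C} {i : V ⟶ Y} {d : Y ⟶ Z}
    (h : IsShortExact E i d) (hV : P.V V) (hT : P.minus T) {t : T ⟶ Y}
    (ht : FactorsThru P.W (t ≫ d)) : FactorsThru P.W t := by
  obtain ⟨W, a, b, hW, hab⟩ := ht
  obtain ⟨c, hc⟩ := exists_lift h hV hW.1 b
  obtain ⟨s, hs⟩ := h.exists_lift (t - a ≫ c) (by simp [hc, hab])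
  exact factorsThru_of_sub (hs ▸ (factorsThru_of_minus hT hV s).comp_right i) ⟨W, a, c, hW, rfl⟩

theorem factorsThru_of_inflation_comp {X Y U T : C} {i : X ⟶ Y} {d : Y ⟶ U}
    (h : IsShortExact E i d) (hU : P.U U) (hT : P.plus T) {t : Y ⟶ T}
    (ht : FactorsThru P.W (i ≫ t)) : FactorsThru P.W t :=
  (op_factorsThru_iff P t).1 (factorsThru_of_comp_deflation (P := P.op) h.op hU
    ((op_minus_iff P T).2 hT) ((op_factorsThru_iff P _).2 ht))

theorem minus_of_inflation {X Y U : C} {i : X ⟶ Y} {d : Y ⟶ U} (h : IsShortExact E i d)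
    (hX : P.minus X) (hU : P.U U) : P.minus Y :=
  minus_of_forall fun _ f hV =>
    factorsThru_of_inflation_comp h hU (plus_of_V hV) (factorsThru_of_minus hX hV (i ≫ f))

theorem plus_of_deflation {V Y Z : C} {i : V ⟶ Y} {d : Y ⟶ Z} (h : IsShortExact E i d)
    (hV : P.V V) (hZ : P.plus Z) : P.plus Y :=
  plus_of_forall fun _ f hU =>
    factorsThru_of_comp_deflation h hV (minus_of_U hU) (factorsThru_of_plus hU hZ (f ≫ d))

theorem minus_biprod {X Y : C} (hX : P.minus X) (hY : P.minus Y) : P.minus (X ⊞ Y) := by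
  refine minus_of_forall fun V f hV => ?_
  have : f = biprod.fst ≫ biprod.inl ≫ f + biprod.snd ≫ biprod.inr ≫ f := by
    rw [← Category.assoc, ← Category.assoc, ← Preadditive.add_comp, biprod.total,
      Category.id_comp]
  rw [this]
  exact factorsThru_add ((factorsThru_of_minus hX hV _).comp_left _)
    ((factorsThru_of_minus hY hV _).comp_left _)

theorem plus_biprod {X Y : C} (hX : P.plus X) (hY : P.plus Y) : P.plus (X ⊞ Y) := by
  refine plus_of_forall fun U f hU => ?_
  have : f = (f ≫ biprod.fst) ≫ biprod.inl + (f ≫ biprod.snd) ≫ biprod.inr := by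
    rw [Category.assoc, Category.assoc, ← Preadditive.comp_add, biprod.total, Category.comp_id]
  rw [this]
  exact factorsThru_add ((factorsThru_of_plus hU hX _).comp_right _)
    ((factorsThru_of_plus hU hY _).comp_right _)

/-! ### Reflection in `plus` and coreflection in `minus`. -/

variable (P) in
/-- The reflection `b : B ⟶ R` of `B` in `plus`, together with the left approximation
`V ⟶ L ⟶ B` from which it is constructed. -/
theorem exists_reflection (B : C) :
    ∃ (R L V U W : C) (i : V ⟶ L) (d : L ⟶ B) (w : L ⟶ W) (e : W ⟶ U) (b : B ⟶ R) (q : W ⟶ R)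
      (c : R ⟶ U), P.V V ∧ P.U L ∧ P.U U ∧ P.W W ∧ P.plus R ∧
      IsShortExact E i d ∧ IsShortExact E w e ∧ IsShortExact E b c ∧
      IsShortExact E (i ≫ w) q ∧ IsPushout d w b q ∧ q ≫ c = e := by
  obtain ⟨V, L, i, d, hV, hL, h⟩ := P.exists_left B
  obtain ⟨W, U, w, e, hW, hU, h'⟩ := P.exists_right L
  -- `R` is the quotient of `W` by `V`, and `V ⟶ W ⟶ R` is what places it in `plus`.
  obtain ⟨R, q, b, c, hq, hb, hqc, sq⟩ := h.exists_comp' h'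
  have hWW : P.W W := ⟨U_of_extension h' hL hU, hW⟩
  exact ⟨R, L, V, U, W, i, d, w, e, b, q, c, hV, hL, hU, hWW, ⟨V, W, _, _, hV, hWW, hq⟩,
    h, h', hb, hq, sq, hqc⟩

/-- The universal property of the reflection in `plus`, and a description of the morphisms
it annihilates. -/
theorem exists_plus_reflection (B : C) :
    ∃ (R U L V : C) (b : B ⟶ R) (c : R ⟶ U) (i : V ⟶ L) (d : L ⟶ B),
      P.plus R ∧ P.U U ∧ IsShortExact E b c ∧ P.V V ∧ P.U L ∧ IsShortExact E i d ∧
      (∀ ⦃Y : C⦄, P.plus Y → ∀ h : B ⟶ Y, ∃ k : R ⟶ Y, b ≫ k = h) ∧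
      (∀ ⦃T : C⦄ (t : T ⟶ B), FactorsThru P.W (t ≫ b) → ∃ s : T ⟶ L, s ≫ d = t) := by
  obtain ⟨R, L, V, U, W, i, d, w, e, b, q, c, hV, hL, hU, hW, hR, h, h', hb, hq, sq, hqc⟩ :=
    P.exists_reflection B
  refine ⟨R, U, L, V, b, c, i, d, hR, hU, hb, hV, hL, h, fun Y hY f => ?_, fun T t ht => ?_⟩
  · obtain ⟨W', x, y, hW', hxy⟩ := factorsThru_of_plus hL hY (d ≫ f)
    obtain ⟨z, hz⟩ := exists_ext h' hU hW'.2 x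
    obtain ⟨k, hk, -⟩ := sq.exists_desc f (z ≫ y) (by rw [← hxy, reassoc_of% hz])
    exact ⟨k, hk⟩
  · obtain ⟨W', x, y, hW', hxy⟩ := ht
    -- The lift `x ≫ z : T ⟶ W` dies in `U`, because `b ≫ c = 0`. So it comes from `L`, and `b`
    -- being monic identifies the result.
    obtain ⟨z, hz⟩ := exists_lift hq hV hW'.1 y
    obtain ⟨s, hs⟩ := h'.exists_lift (x ≫ z) (by
      rw [← hqc, Category.assoc, reassoc_of% hz, reassoc_of% hxy, hb.w, comp_zero])
    have := hb.mono
    refine ⟨s, ?_⟩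
    rw [← cancel_mono b, Category.assoc, sq.w, reassoc_of% hs, hz, hxy]

/-- Coreflections of objects in `minus`. -/
theorem exists_coreflection (L : C) :
    ∃ (K V R W U : C) (i : V ⟶ K) (d : K ⟶ L) (w : W ⟶ R) (j : V ⟶ W) (l : L ⟶ R) (k : K ⟶ W)
      (e : W ⟶ U), P.V V ∧ P.V R ∧ P.W W ∧ P.U U ∧ P.minus K ∧ IsShortExact E i d ∧
      IsShortExact E j w ∧ IsShortExact E k e ∧ i ≫ k = j ∧ Mono l ∧ d ≫ l = k ≫ w := by
  obtain ⟨R, L', V, U, W, i, d, w, e, b, q, c, hV, hL, hU, hW, hR, h, h', hb, hq, sq, hqc⟩ :=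
    P.op.exists_reflection (.op L)
  exact ⟨R.unop, U.unop, L'.unop, W.unop, V.unop, c.unop, b.unop, w.unop, e.unop, d.unop, q.unop,
    _, hU, hL, hW.symm, hV, (op_plus_iff P _).1 hR, hb.unop, h'.unop, hq.unop,
    Quiver.Hom.op_inj hqc, h.unop.mono, Quiver.Hom.op_inj sq.w⟩

/-! ### Kernels and cokernels modulo `W`, stated in `C`. -/

variable (P) in
/-- The objects of the heart. -/
def InHeart (B : C) : Prop := P.plus B ∧ P.minus B

/-- If every morphism from an object of the heart to `L` factors through `W`, then `L` lies
in `V`. -/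
theorem V_of_forall_factorsThru {L : C} (hL : P.plus L)
    (H : ∀ ⦃T : C⦄, P.InHeart T → ∀ t : T ⟶ L, FactorsThru P.W t) : P.V L := by
  obtain ⟨K, V, R, W, U, i, d, w, j, l, k, e, hV, hR, hW, hU, hK, h, h', hk, hik, hl, hdl⟩ :=
    P.exists_coreflection L
  -- The coreflection `K` lies in the heart, so `d` factors through `W` by `H`. Then so does `𝟙 K`,
  -- which makes `K` a retract of an object of `W`.
  have hKid : FactorsThru P.W (𝟙 K) :=
    factorsThru_of_comp_deflation h hV hK (by
      simpa using H ⟨plus_of_deflation h hV hL, hK⟩ d)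
  obtain ⟨W', x, y, hW', hxy⟩ := hKid
  have hKV : P.V K := V_of_retract x y hxy hW'.2
  -- Since `K` is in `V`, its identity extends over `W`. The composite `r ≫ d` kills `V` and
  -- descends to `R ⟶ L`, so `L` is a retract of `R`.
  obtain ⟨r, hr⟩ := exists_ext hk hU hKV (𝟙 K)
  obtain ⟨s, hs⟩ := h'.exists_desc (r ≫ d) (by
    rw [← hik, Category.assoc, reassoc_of% hr, h.w])
  have := h.epi
  refine V_of_retract l s ?_ hR
  rw [← cancel_epi d, reassoc_of% hdl, hs, reassoc_of% hr, Category.comp_id]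

/-- An inflation between objects of the heart with cokernel in `U` that is a monomorphism modulo
`W` is a split monomorphism with complement in `W`. -/
theorem exists_retraction {A N U : C} {a : A ⟶ N} {d : N ⟶ U} (h : IsShortExact E a d)
    (hU : P.U U) (hA : P.InHeart A) (hN : P.InHeart N)
    (ha : ∀ ⦃T : C⦄, P.InHeart T → ∀ t : T ⟶ A, FactorsThru P.W (t ≫ a) → FactorsThru P.W t) :
    ∃ r : N ⟶ A, FactorsThru P.W (r ≫ a - 𝟙 N) := by
  obtain ⟨V, W, i, p, hV, hW, h'⟩ := hN.1
  -- `L` is the kernel of `W ⟶ N ⟶ U`. Showing that `L` lies in `V` splits `L ⟶ W ⟶ U`, so that `U`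
  -- becomes a retract of `W`.
  obtain ⟨L, k, q, b, hk, hb, -, sq⟩ := h.exists_comp h'
  have hL : P.V L := V_of_forall_factorsThru (plus_of_deflation hb hV hA.1) fun T hT t =>
    factorsThru_of_comp_deflation hb hV hT.2 (ha hT _ ⟨W, t ≫ k, p, hW, by simp [sq.w]⟩)
  obtain ⟨s, hs⟩ := exists_lift hk hL hU (𝟙 U)
  have hWU : P.W U := ⟨hU, V_of_retract s (p ≫ d) hs hW.2⟩
  obtain ⟨r, hr⟩ := h.exists_lift (𝟙 N - d ≫ s ≫ p) (by simp [hs])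
  exact ⟨r, U, -d, s ≫ p, hWU, by rw [hr]; simp⟩

/-- The cokernel of a morphism in the heart; a morphism with trivial kernel is the kernel of its
cokernel. -/
theorem exists_cokernel {A B : C} (hA : P.InHeart A) (hB : P.InHeart B) (f : A ⟶ B) :
    ∃ (D : C) (g : B ⟶ D), P.InHeart D ∧ FactorsThru P.W (f ≫ g) ∧
      (∀ ⦃Y : C⦄, P.InHeart Y → ∀ h : B ⟶ Y, FactorsThru P.W (f ≫ h) → ∃ k : D ⟶ Y, g ≫ k = h) ∧
      (∀ ⦃Y : C⦄, P.InHeart Y → ∀ k : D ⟶ Y, FactorsThru P.W (g ≫ k) → FactorsThru P.W k) ∧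
      ((∀ ⦃T : C⦄, P.InHeart T → ∀ t : T ⟶ A, FactorsThru P.W (t ≫ f) → FactorsThru P.W t) →
        ∀ ⦃T : C⦄, P.InHeart T → ∀ t : T ⟶ B, FactorsThru P.W (t ≫ g) →
          ∃ s : T ⟶ A, FactorsThru P.W (s ≫ f - t)) := by
  obtain ⟨W, U, i, d, hW, hU, h⟩ := hA.2
  obtain ⟨M, b, w, e, hM, hb⟩ := h.exists_biprod_lift f
  obtain ⟨D, U', L, V, m, c, j, p, hD, hU', hm, hV, hL, hj, hext, hlift⟩ :=
    P.exists_plus_reflection M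
  have hfb : f ≫ b = i ≫ (-w) := by
    have := hM.w
    rw [Preadditive.comp_neg, ← add_eq_zero_iff_eq_neg]
    simpa using this
  refine ⟨D, b ≫ m, ⟨hD, minus_of_inflation hm (minus_of_inflation hb hB.2 hU) hU'⟩,
    ⟨W, i, (-w) ≫ m, hW, by rw [← Category.assoc, ← hfb, Category.assoc]⟩, ?_, ?_, ?_⟩
  · rintro Y hY x ⟨W', y, z, hW', hyz⟩
    -- Extending `y` over `W` corrects `x` to a map on `B ⊞ W` that vanishes on the nose on `A`.
    obtain ⟨y', hy'⟩ := exists_ext h hU hW'.2 y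
    obtain ⟨k, hk⟩ := hM.exists_desc (biprod.desc x (-(y' ≫ z))) (by
      simp [reassoc_of% hy', hyz])
    obtain ⟨k', hk'⟩ := hext hY.1 k
    refine ⟨k', ?_⟩
    rw [Category.assoc, hk']
    simpa using congr(biprod.inl ≫ $hk)
  · intro Y hY k hk
    exact factorsThru_of_inflation_comp hm hU' hY.1
      (factorsThru_of_inflation_comp hb hU hY.1 (by simpa using hk))
  · intro hf T hT t ht
    obtain ⟨N, a, q, n, hN, hn, haq, sq⟩ : ∃ (N : C) (a : A ⟶ N) (q : N ⟶ B ⊞ W) (n : N ⟶ L),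
        IsShortExact E a n ∧ (∃ v : V ⟶ N, IsShortExact E v q) ∧ a ≫ q = biprod.lift f i ∧
        IsPullback q n (biprod.desc b w) p := by
      obtain ⟨N, a, q, n, haq, sq, h'⟩ := hM.exists_pullback p
      obtain ⟨v, -, hv⟩ := hj.of_isPullback sq.flip
      exact ⟨N, a, q, n, h', ⟨v, hv⟩, haq, sq⟩
    obtain ⟨v, hv⟩ := hn
    have hNH : P.InHeart N :=
      ⟨plus_of_deflation hv hV (plus_biprod hB.1 (plus_of_V hW.2)),
        minus_of_inflation hN hA.2 hL⟩
    -- `a` is monic modulo `W` because composing it with `q ≫ biprod.fst` gives `f`.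
    obtain ⟨r, hr⟩ := exists_retraction hN hL hA hNH fun T hT t ht => hf hT t (by
      have := ht.comp_right (q ≫ biprod.fst)
      rwa [Category.assoc, reassoc_of% haq, biprod.lift_fst] at this)
    obtain ⟨s, hs⟩ := hlift (t ≫ b) (by simpa using ht)
    -- `(t, 0)` and `s` glue to `x : T ⟶ N`. Since `r ≫ a` is the identity modulo `W`, `x ≫ r ≫ f`
    -- agrees with `x ≫ q ≫ biprod.fst = t`.
    obtain ⟨x, hx, -⟩ := sq.exists_lift (t ≫ biprod.inl) s (by simp [hs])
    refine ⟨x ≫ r, ?_⟩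
    have := (hr.comp_right (q ≫ biprod.fst)).comp_left x
    rwa [Preadditive.sub_comp, Preadditive.comp_sub, Category.assoc, reassoc_of% haq,
      biprod.lift_fst, Category.id_comp, reassoc_of% hx, biprod.inl_fst, Category.comp_id,
      ← Category.assoc] at this

variable (P) in
theorem op_inHeart_iff (X : C) : P.op.InHeart (.op X) ↔ P.InHeart X := by
  rw [InHeart, op_plus_iff, op_minus_iff, and_comm, InHeart]

/-- The kernel of a morphism in the heart; a morphism with trivial cokernel is the cokernel of its
kernel. -/
theorem exists_kernel {A B : C} (hA : P.InHeart A) (hB : P.InHeart B) (f : A ⟶ B) :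
    ∃ (K : C) (g : K ⟶ A), P.InHeart K ∧ FactorsThru P.W (g ≫ f) ∧
      (∀ ⦃Y : C⦄, P.InHeart Y → ∀ h : Y ⟶ A, FactorsThru P.W (h ≫ f) → ∃ k : Y ⟶ K, k ≫ g = h) ∧
      (∀ ⦃Y : C⦄, P.InHeart Y → ∀ k : Y ⟶ K, FactorsThru P.W (k ≫ g) → FactorsThru P.W k) ∧
      ((∀ ⦃T : C⦄, P.InHeart T → ∀ t : B ⟶ T, FactorsThru P.W (f ≫ t) → FactorsThru P.W t) →
        ∀ ⦃T : C⦄, P.InHeart T → ∀ t : A ⟶ T, FactorsThru P.W (g ≫ t) →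
          ∃ s : B ⟶ T, FactorsThru P.W (f ≫ s - t)) := by
  obtain ⟨K, g, hK, h₁, h₂, h₃, h₄⟩ := exists_cokernel (P := P.op)
    ((op_inHeart_iff P _).2 hB) ((op_inHeart_iff P _).2 hA) f.op
  refine ⟨K.unop, g.unop, (op_inHeart_iff P _).1 hK, (op_factorsThru_iff P _).1 h₁, ?_, ?_, ?_⟩
  · intro Y hY h hh
    obtain ⟨k, hk⟩ := h₂ ((op_inHeart_iff P _).2 hY) h.op ((op_factorsThru_iff P _).2 hh)
    exact ⟨k.unop, Quiver.Hom.op_inj hk⟩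
  · intro Y hY k hk
    exact (op_factorsThru_iff P _).1
      (h₃ ((op_inHeart_iff P _).2 hY) k.op ((op_factorsThru_iff P _).2 hk))
  · intro hf T hT t ht
    obtain ⟨s, hs⟩ := h₄ (fun T hT t ht => (op_factorsThru_iff P t.unop).2
      (hf ((op_inHeart_iff P _).1 hT) t.unop ((op_factorsThru_iff P _).1 ht)))
      ((op_inHeart_iff P _).2 hT) t.op ((op_factorsThru_iff P _).2 ht)
    exact ⟨s.unop, (op_factorsThru_iff P _).1 hs⟩

end CotorsionPair

end ExactCat

/-! ### Transfer to the quotient category and the abelian structure. -/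

namespace ExactCat

variable {C : Type u} [Category.{v} C] [Preadditive C]

namespace CotorsionPair

variable [HasBinaryBiproducts C] {E : ExactStructure C} {P : CotorsionPair E}

/-- An object satisfying `InHeart` as an object of the heart. -/
def InHeart.toHeart {A : C} (hA : P.InHeart A) : P.Heart := ⟨⟨A⟩, hA⟩

/-- The image in the heart of a morphism between underlying objects. -/
def heartMap {X Y : P.Heart} (f : X.obj.as ⟶ Y.obj.as) : X ⟶ Y :=
  ObjectProperty.homMk ((Quotient.functor (factorRel P.W)).map f)

theorem InHeart.exists_heart {A : C} (hA : P.InHeart A) : ∃ X : P.Heart, X.obj.as = A :=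
  ⟨hA.toHeart, rfl⟩

theorem heartMap_surjective {X Y : P.Heart} (f : X ⟶ Y) : ∃ g, heartMap g = f := by
  obtain ⟨g, hg⟩ := (Quotient.functor (factorRel P.W)).map_surjective f.hom
  exact ⟨g, by ext; exact hg⟩

theorem heartMap_comp {X Y Z : P.Heart} (f : X.obj.as ⟶ Y.obj.as) (g : Y.obj.as ⟶ Z.obj.as) :
    heartMap (X := X) (Y := Z) (f ≫ g) = heartMap f ≫ heartMap g := by
  ext
  exact (Quotient.functor (factorRel P.W)).map_comp f g

theorem heartMap_id (X : P.Heart) : heartMap (X := X) (Y := X) (𝟙 X.obj.as) = 𝟙 X := by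
  ext
  exact (Quotient.functor (factorRel P.W)).map_id _

variable [HasZeroObject C]

theorem heartMap_add {X Y : P.Heart} (f g : X.obj.as ⟶ Y.obj.as) :
    heartMap (X := X) (Y := Y) (f + g) = heartMap f + heartMap g := rfl

theorem heartMap_eq_iff {X Y : P.Heart} (f g : X.obj.as ⟶ Y.obj.as) :
    heartMap (X := X) (Y := Y) f = heartMap g ↔ FactorsThru P.W (f - g) := by
  refine Iff.trans ⟨fun h => congr_arg (·.hom) h, fun h => by ext; exact h⟩
    (Quotient.functor_map_eq_iff (factorRel P.W) f g)

theorem heartMap_zero (X Y : P.Heart) : heartMap (X := X) (Y := Y) 0 = 0 := rfl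

theorem heartMap_eq_zero_iff {X Y : P.Heart} (f : X.obj.as ⟶ Y.obj.as) :
    heartMap (X := X) (Y := Y) f = 0 ↔ FactorsThru P.W f := by
  rw [← heartMap_zero, heartMap_eq_iff, sub_zero]

theorem heart_hasBinaryBiproducts : HasBinaryBiproducts P.Heart where
  has_binary_biproduct X Y := by
    obtain ⟨Z, p, q, i, j, hip, hiq, hjp, hjq, h⟩ : ∃ (Z : P.Heart) (p : Z.obj.as ⟶ X.obj.as)
        (q : Z.obj.as ⟶ Y.obj.as) (i : X.obj.as ⟶ Z.obj.as) (j : Y.obj.as ⟶ Z.obj.as),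
        i ≫ p = 𝟙 _ ∧ i ≫ q = 0 ∧ j ≫ p = 0 ∧ j ≫ q = 𝟙 _ ∧ p ≫ i + q ≫ j = 𝟙 _ :=
      ⟨InHeart.toHeart ⟨plus_biprod X.property.1 Y.property.1,
        minus_biprod X.property.2 Y.property.2⟩, biprod.fst, biprod.snd, biprod.inl, biprod.inr,
        biprod.inl_fst, biprod.inl_snd, biprod.inr_fst, biprod.inr_snd, biprod.total⟩
    refine hasBinaryBiproduct_of_total
      { pt := Z
        fst := heartMap p
        snd := heartMap q
        inl := heartMap i
        inr := heartMap j
        inl_fst := by rw [← heartMap_comp, hip, heartMap_id]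
        inl_snd := by rw [← heartMap_comp, hiq, heartMap_zero]
        inr_fst := by rw [← heartMap_comp, hjp, heartMap_zero]
        inr_snd := by rw [← heartMap_comp, hjq, heartMap_id] } ?_
    change heartMap p ≫ heartMap i + heartMap q ≫ heartMap j = 𝟙 Z
    rw [← heartMap_comp, ← heartMap_comp, ← heartMap_add, h, heartMap_id]

theorem heart_hasZeroObject : HasZeroObject P.Heart := by
  obtain ⟨W, hW⟩ := P.exists_W
  refine ⟨InHeart.toHeart ⟨plus_of_V hW.2, minus_of_U hW.1⟩, ?_⟩
  rw [IsZero.iff_id_eq_zero, ← heartMap_id, heartMap_eq_zero_iff]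
  exact ⟨W, 𝟙 W, 𝟙 W, hW, Category.comp_id _⟩

/-- Turns monicity in the heart into the cancellation hypothesis on representatives required by
`exists_cokernel`. -/
theorem factorsThru_of_mono {X Y : P.Heart} (f : X.obj.as ⟶ Y.obj.as)
    [Mono (heartMap (X := X) (Y := Y) f)] ⦃T : C⦄ (hT : P.InHeart T) (t : T ⟶ X.obj.as)
    (ht : FactorsThru P.W (t ≫ f)) : FactorsThru P.W t := by
  obtain ⟨T, rfl⟩ := hT.exists_heart
  rw [← heartMap_eq_zero_iff, ← cancel_mono (heartMap (X := X) (Y := Y) f), ← heartMap_comp, zero_comp,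
    heartMap_eq_zero_iff]
  exact ht

theorem factorsThru_of_epi {X Y : P.Heart} (f : X.obj.as ⟶ Y.obj.as)
    [Epi (heartMap (X := X) (Y := Y) f)] ⦃T : C⦄ (hT : P.InHeart T) (t : Y.obj.as ⟶ T)
    (ht : FactorsThru P.W (f ≫ t)) : FactorsThru P.W t := by
  obtain ⟨T, rfl⟩ := hT.exists_heart
  rw [← heartMap_eq_zero_iff, ← cancel_epi (heartMap (X := X) (Y := Y) f), ← heartMap_comp, comp_zero,
    heartMap_eq_zero_iff]
  exact ht

theorem heart_exists_cokernel {X Y : P.Heart} (f : X ⟶ Y) :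
    ∃ (Z : P.Heart) (g : Y ⟶ Z) (w : f ≫ g = 0),
      Nonempty (IsColimit (CokernelCofork.ofπ g w)) ∧
        (Mono f → Nonempty (IsLimit (KernelFork.ofι f w))) := by
  obtain ⟨f, rfl⟩ := heartMap_surjective f
  obtain ⟨D, g, hD, h₁, h₂, h₃, h₄⟩ := exists_cokernel X.property Y.property f
  obtain ⟨Z, rfl⟩ := hD.exists_heart
  have w : heartMap (X := X) (Y := Y) f ≫ heartMap (Y := Z) g = 0 := by
    rw [← heartMap_comp, heartMap_eq_zero_iff]
    exact h₁
  have hg : Epi (heartMap (X := Y) (Y := Z) g) := by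
    refine Preadditive.epi_of_cancel_zero _ fun {T} t ht => ?_
    obtain ⟨t, rfl⟩ := heartMap_surjective t
    rw [← heartMap_comp, heartMap_eq_zero_iff] at ht
    exact (heartMap_eq_zero_iff _).2 (h₃ T.property t ht)
  have hdesc {T : P.Heart} (t : Y ⟶ T) (ht : heartMap (X := X) f ≫ t = 0) :
      ∃ s : Z ⟶ T, heartMap g ≫ s = t := by
    obtain ⟨t, rfl⟩ := heartMap_surjective t
    rw [← heartMap_comp, heartMap_eq_zero_iff] at ht
    obtain ⟨s, hs⟩ := h₂ T.property t ht
    exact ⟨heartMap (X := Z) s, by rw [← heartMap_comp, hs]⟩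
  refine ⟨Z, _, w, ⟨CokernelCofork.IsColimit.ofπ' _ w fun t ht =>
    ⟨(hdesc t ht).choose, (hdesc t ht).choose_spec⟩⟩, fun hf => ?_⟩
  have hlift {T : P.Heart} (t : T ⟶ Y) (ht : t ≫ heartMap (Y := Z) g = 0) :
      ∃ s : T ⟶ X, s ≫ heartMap f = t := by
    obtain ⟨t, rfl⟩ := heartMap_surjective t
    rw [← heartMap_comp, heartMap_eq_zero_iff] at ht
    obtain ⟨s, hs⟩ := h₄ (factorsThru_of_mono f) T.property t ht
    exact ⟨heartMap (X := T) (Y := X) s, by rwa [← heartMap_comp, heartMap_eq_iff]⟩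
  exact ⟨KernelFork.IsLimit.ofι' _ w fun t ht =>
    ⟨(hlift t ht).choose, (hlift t ht).choose_spec⟩⟩

theorem heart_exists_kernel {X Y : P.Heart} (f : X ⟶ Y) :
    ∃ (Z : P.Heart) (g : Z ⟶ X) (w : g ≫ f = 0),
      Nonempty (IsLimit (KernelFork.ofι g w)) ∧
        (Epi f → Nonempty (IsColimit (CokernelCofork.ofπ f w))) := by
  obtain ⟨f, rfl⟩ := heartMap_surjective f
  obtain ⟨K, g, hK, h₁, h₂, h₃, h₄⟩ := exists_kernel X.property Y.property f
  obtain ⟨Z, rfl⟩ := hK.exists_heart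
  have w : heartMap (X := Z) (Y := X) g ≫ heartMap (Y := Y) f = 0 := by
    rw [← heartMap_comp, heartMap_eq_zero_iff]
    exact h₁
  have hg : Mono (heartMap (X := Z) (Y := X) g) := by
    refine Preadditive.mono_of_cancel_zero _ fun {T} t ht => ?_
    obtain ⟨t, rfl⟩ := heartMap_surjective t
    rw [← heartMap_comp, heartMap_eq_zero_iff] at ht
    exact (heartMap_eq_zero_iff _).2 (h₃ T.property t ht)
  have hlift {T : P.Heart} (t : T ⟶ X) (ht : t ≫ heartMap (Y := Y) f = 0) :
      ∃ s : T ⟶ Z, s ≫ heartMap g = t := by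
    obtain ⟨t, rfl⟩ := heartMap_surjective t
    rw [← heartMap_comp, heartMap_eq_zero_iff] at ht
    obtain ⟨s, hs⟩ := h₂ T.property t ht
    exact ⟨heartMap (Y := Z) s, by rw [← heartMap_comp, hs]⟩
  refine ⟨Z, _, w, ⟨KernelFork.IsLimit.ofι' _ w fun t ht =>
    ⟨(hlift t ht).choose, (hlift t ht).choose_spec⟩⟩, fun hf => ?_⟩
  have hdesc {T : P.Heart} (t : X ⟶ T) (ht : heartMap (X := Z) g ≫ t = 0) :
      ∃ s : Y ⟶ T, heartMap f ≫ s = t := by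
    obtain ⟨t, rfl⟩ := heartMap_surjective t
    rw [← heartMap_comp, heartMap_eq_zero_iff] at ht
    obtain ⟨s, hs⟩ := h₄ (factorsThru_of_epi f) T.property t ht
    exact ⟨heartMap (X := Y) (Y := T) s, by rwa [← heartMap_comp, heartMap_eq_iff]⟩
  exact ⟨CokernelCofork.IsColimit.ofπ' _ w fun t ht =>
    ⟨(hdesc t ht).choose, (hdesc t ht).choose_spec⟩⟩

variable (P) in
/-- The heart of a cotorsion pair is abelian. -/
@[reducible]
noncomputable def heartAbelian : Abelian P.Heart :=
  { (inferInstance : Preadditive P.Heart) with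
    normalMonoOfMono := fun f _ => by
      obtain ⟨Z, g, w, -, h⟩ := heart_exists_cokernel f
      obtain ⟨l⟩ := h inferInstance
      exact ⟨⟨Z, g, w, l⟩⟩
    normalEpiOfEpi := fun f _ => by
      obtain ⟨Z, g, w, -, h⟩ := heart_exists_kernel f
      obtain ⟨l⟩ := h inferInstance
      exact ⟨⟨Z, g, w, l⟩⟩
    has_finite_products := by
      have := heart_hasBinaryBiproducts (P := P)
      have := heart_hasZeroObject (P := P)
      exact hasFiniteProducts_of_has_binary_and_terminal
    has_kernels := ⟨fun f => by
      obtain ⟨Z, g, w, ⟨l⟩, -⟩ := heart_exists_kernel f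
      exact ⟨⟨_, l⟩⟩⟩
    has_cokernels := ⟨fun f => by
      obtain ⟨Z, g, w, ⟨l⟩, -⟩ := heart_exists_cokernel f
      exact ⟨⟨_, l⟩⟩⟩ }

end CotorsionPair

end ExactCat

/-- The equation ensures that the addition on morphisms is the one inherited from the quotient. -/
theorem theorem4 {C : Type u} [Category.{v} C] [Preadditive C] [HasZeroObject C] [HasBinaryBiproducts C]
    (E : ExactCat.ExactStructure C)
    (hproj : ExactCat.HasEnoughProjectives E) (hinj : ExactCat.HasEnoughInjectives E)
    (P : ExactCat.CotorsionPair E) :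
    ∃ A : Abelian P.Heart,
      A.toPreadditive = (inferInstance : Preadditive P.Heart) :=
  ⟨P.heartAbelian, rfl⟩
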